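/- Let $K$ be a number field of degree $d$ with ring of integers $\mathcal O$, let $S$ be the set of its Archimedean places, $K_S=\prod_{v\in S}K_v$ with coordinatewise multiplication and the sup norm $\|\mathbf x\|=\max_{v\in S}|x_v|$, and let $\iota:K\to K_S$ be the diagonal embedding. Let $\mathbf{BA}_K$ be the set of all $\mathbf x\in K_S$ for which there is $c>0$ with $\|\iota(q)\mathbf x+\iota(p)\|>c\,\|\iota(q)\|^{-1}$ for all $p\in\mathcal O$, $q\in\mathcal O\smallsetminus\{0\}$. Let $X$ be a complete metric space and let $Y\subseteq X$ be non-empty and closed. A formal ball is a pair $B=(c,r)\in X\times\mathbb R_{>0}$, with corresponding closed ball $\mathbf B(B)=\{y\in X:\operatorname{dist}(y,c)\le r\}$; write $(c,r)\preceq(c',r')$ if $\operatorname{dist}(c,c')\le r'-r$. *Absolute game.* Let $0<\beta<1$. In the $\beta$-absolute game on $Y$, Bob and Alice alternately choose $B_1,A_1,B_2,A_2,\dots$, where Bob's moves are $B_n=(c_n,r_n)\in Y\times\mathbb R_{>0}$, Alice's moves are $A_n=(x_n,\rho_n)\in X\times\mathbb R_{>0}$ with $\rho_n\le\beta r_n$,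 and Bob must satisfy $\beta r_n\le r_{n+1}\le r_n$, $B_{n+1}\preceq B_n$ and $\operatorname{dist}(c_{n+1},x_n)>\rho_n+r_{n+1}$. A set $W\subseteq X$ is *absolute winning on $Y$* if there is $\beta_0>0$ such that for every $0<\beta<\beta_0$ with $\beta<1$ Alice has a strategy in this game ensuring that Bob always has a legal move and that $W\cap Y\cap\bigcap_n\mathbf B(B_n)\ne\varnothing$, whatever Bob does. *Schmidt's game.* Let $0<\alpha,\beta<1$. In Schmidt's $(\alpha,\beta)$-game on $Y$, Bob and Alice alternately choose $B_1,A_1,B_2,A_2,\dots\in Y\times\mathbb R_{>0}$ with $r(A_n)=\alpha r(B_n)$, $A_n\preceq B_n$, $r(B_{n+1})=\beta r(A_n)$ and $B_{n+1}\preceq A_n$, where $r(\cdot)$ is the radius. A set $W\subseteq X$ is *winning on $Y$ in the sense of Schmidt* if there is $0<\alpha<1$ such that for every $0<\beta<1$ Alice has a strategy ensuring that the point of $Y\cap\bigcap_n\mathbf B(B_n)$ lies in $W$. **Corollary 1.4.** Let $\phi:[0,1]\to K_S$ be a $C^1$ curve (with one-sided derivatives at the end points). For $x\in[0,1]$ put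 $T(x)=\{v\in S:\phi_v'(x)\ne0\}$, and let $T(x)_{\mathbb R}$ and $T(x)_{\mathbb C}$ be the sets of real and of complex places in $T(x)$. Suppose that for all but countably many $x\in[0,1]$ $$\#T(x)_{\mathbb R}+2\,\#T(x)_{\mathbb C}>\frac d2 .$$ Then $\phi^{-1}(\mathbf{BA}_K)$ is absolute winning on $Y=[0,1]\subseteq X=\mathbb R$. In particular, $\phi^{-1}(\mathbf{BA}_K)$ is winning on $[0,1]$ in the sense of Schmidt (the winning statement of Einsiedler, Ghosh and Lytle, who allow only finitely many exceptional $x$). -/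

import Mathlib

open NumberField Set
open scoped Classical

/-! ### Games on formal balls

A formal ball `(c, r)` of a metric space `X` is an element of `X × ℝ` with `0 < r`; positivity
of the radius is part of the rules below. Moves are numbered from `0`. -/

section Games

variable {X : Type*} [MetricSpace X]

/-- The partial order on formal balls: `FormalLE b₁ b₂` iff
`dist (c b₁) (c b₂) ≤ r b₂ - r b₁`. -/
def FormalLE (b₁ b₂ : X × ℝ) : Prop :=
  dist b₁.1 b₂.1 ≤ b₂.2 - b₁.2

/-- The moves `B 0, …, B n`, in order: all that a strategy for Alice is shown at her
`n`-th move. -/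
def history (B : ℕ → X × ℝ) (n : ℕ) : List (X × ℝ) :=
  (List.range (n + 1)).map B

/-- `b'` is a legal answer of Bob in the absolute game on `Y` with parameter `β`, after his own
move `b` and Alice's answer `a = (L, ρ)`, which deletes the `ρ`-neighbourhood of `L`.
The distance is `[0, ∞]`-valued, so that the distance to the empty set is infinite. -/
def AbsoluteNext (Y : Set X) (β : ℝ) (b : X × ℝ) (a : Set X × ℝ) (b' : X × ℝ) : Prop :=
  b'.1 ∈ Y ∧ 0 < b'.2 ∧ β * b.2 ≤ b'.2 ∧ b'.2 ≤ b.2 ∧ FormalLE b' b ∧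
    ENNReal.ofReal (a.2 + b'.2) < Metric.infEDist b'.1 a.1

/-- `B 0, …, B n` are legal moves of Bob in the absolute game on `Y` with parameter `β`,
Alice answering by the strategy `σ`. -/
def IsAbsolutePlay (Y : Set X) (β : ℝ) (σ : List (X × ℝ) → Set X × ℝ) (B : ℕ → X × ℝ) (n : ℕ) :
    Prop :=
  (B 0).1 ∈ Y ∧ 0 < (B 0).2 ∧
    ∀ i < n, AbsoluteNext Y β (B i) (σ (history B i)) (B (i + 1))

/-- `W` is `(ℋ, β)`-absolute winning on `Y`: Alice has a strategy `σ` such that in every play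
against it her moves are legal, Bob always has a legal move, and if the play is infinite then
the intersection of Bob's balls meets `W ∩ Y`. -/
def IsAbsoluteWinningWith (ℋ : Set (Set X)) (β : ℝ) (Y W : Set X) : Prop :=
  ∃ σ : List (X × ℝ) → Set X × ℝ, ∀ B : ℕ → X × ℝ,
    (∀ n, IsAbsolutePlay Y β σ B n →
      ((σ (history B n)).1 ∈ ℋ ∧ 0 < (σ (history B n)).2 ∧
        (σ (history B n)).2 ≤ β * (B n).2) ∧
      ∃ b', AbsoluteNext Y β (B n) (σ (history B n)) b') ∧
    ((∀ n, IsAbsolutePlay Y β σ B n) →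
      (W ∩ Y ∩ ⋂ n, Metric.closedBall (B n).1 (B n).2).Nonempty)

/-- `W` is `ℋ`-absolute winning on `Y`. -/
def IsHAbsoluteWinningOn (ℋ : Set (Set X)) (Y W : Set X) : Prop :=
  ∃ β₀ : ℝ, 0 < β₀ ∧ β₀ ≤ 1 ∧ ∀ β : ℝ, 0 < β → β < β₀ → IsAbsoluteWinningWith ℋ β Y W

/-- `W` is absolute winning on `Y ⊆ X` (McMullen's game): the deleted sets are neighbourhoods
of points of `X`. -/
def IsAbsoluteWinningOn (Y W : Set X) : Prop :=
  IsHAbsoluteWinningOn {L : Set X | ∃ x : X, L = {x}} Y W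

/-- `B 0, …, B n` are legal moves of Bob in Schmidt's `(α, β)`-game on `Y` (with the induced
metric), Alice answering by the strategy `σ`. -/
def IsSchmidtPlay (Y : Set X) (β : ℝ) (σ : List (X × ℝ) → X × ℝ) (B : ℕ → X × ℝ) (n : ℕ) :
    Prop :=
  (B 0).1 ∈ Y ∧ 0 < (B 0).2 ∧
    ∀ i < n, (B (i + 1)).1 ∈ Y ∧ (B (i + 1)).2 = β * (σ (history B i)).2 ∧
      FormalLE (B (i + 1)) (σ (history B i))

/-- `W ∩ Y` is `(α, β)`-winning for Schmidt's game on `Y` (with the induced metric). -/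
def IsSchmidtWinningWith (α β : ℝ) (Y W : Set X) : Prop :=
  ∃ σ : List (X × ℝ) → X × ℝ, ∀ B : ℕ → X × ℝ,
    (∀ n, IsSchmidtPlay Y β σ B n →
      (σ (history B n)).1 ∈ Y ∧ (σ (history B n)).2 = α * (B n).2 ∧
        FormalLE (σ (history B n)) (B n)) ∧
    ((∀ n, IsSchmidtPlay Y β σ B n) →
      (W ∩ Y ∩ ⋂ n, Metric.closedBall (B n).1 (B n).2).Nonempty)

/-- `W ∩ Y` is winning for Schmidt's game on `Y`: for some `α ∈ (0, 1)` it is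
`(α, β)`-winning for all `β ∈ (0, 1)`. -/
def IsSchmidtWinningOn (Y W : Set X) : Prop :=
  ∃ α : ℝ, 0 < α ∧ α < 1 ∧ ∀ β : ℝ, 0 < β → β < 1 → IsSchmidtWinningWith α β Y W

end Games

/-! ### Badly approximable `S`-numbers

`K_S`, the product of the completions of `K` at its Archimedean places, is Mathlib's
`mixedEmbedding.mixedSpace K`, the product of a copy of `ℝ` for each real place and a copy of `ℂ`
for each complex place, with coordinatewise multiplication and the sup norm; the diagonal
embedding is `mixedEmbedding K`. -/

section BadlyApproximable

variable (K : Type*) [Field K] [NumberField K]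

/-- The set of badly approximable `S`-numbers. -/
def badlyApproximable : Set (mixedEmbedding.mixedSpace K) :=
  {x | ∃ c : ℝ, 0 < c ∧ ∀ p q : 𝓞 K, q ≠ 0 →
    c * ‖mixedEmbedding K (q : K)‖⁻¹ <
      ‖mixedEmbedding K (q : K) * x + mixedEmbedding K (p : K)‖}

variable {K}

/-- The real places `v` with `φ'_v(x) ≠ 0`, for a curve `φ` on `[0, 1]` (one-sided derivatives
at the end points). -/
def movingReal (φ : ℝ → mixedEmbedding.mixedSpace K) (x : ℝ) :
    Set {v : InfinitePlace K // v.IsReal} :=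
  {v | (derivWithin φ (Icc 0 1) x).1 v ≠ 0}

/-- The complex places `v` with `φ'_v(x) ≠ 0`, for a curve `φ` on `[0, 1]`. -/
def movingComplex (φ : ℝ → mixedEmbedding.mixedSpace K) (x : ℝ) :
    Set {v : InfinitePlace K // v.IsComplex} :=
  {v | (derivWithin φ (Icc 0 1) x).2 v ≠ 0}

end BadlyApproximable

/-! Fix a large `G` and a small `c`. If no `k` admits an approximation `-p / q` of `φ x` with `q`
below `G ^ k` and error at most `c / G ^ k` at every place, then `φ x` is badly approximable. Height
`1` is impossible, since a nonzero integer has size at least `1` at some place.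

Suppose an approximation exists at height `G * H`, and let `T` be a set of places carrying more than
half the degree. Minkowski's theorem gives a nonzero integer `a` below `G` on `T` and below `G⁻¹`
off `T`. Multiplying `p` and `q` by `a` gives an approximation at height `H`, unless `q` is already
comparable to `G * H` at some `v ∈ T` (`IsApproximable.descent`). Hence it suffices to avoid, for
all `k` and all `v ∈ T`, the parameters approximated at height `G ^ k` with `q` large at `v`.

These parameters form short obstacles. At parameter distance of order `G ^ (-2k)` two approximations
have the same quotient, because `p q' - p' q` is an integer less than `1` at every place. As `q` and
`q'` are large at `v`, the two points of the curve are then very close at `v`, and `φ_v` is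
bi-Lipschitz where `φ_v' ≠ 0`. So a ball at scale `k` meets at most one short obstacle for each
place, and Alice deletes them one by one before Bob reaches the next scale (`not_mem_obstacle`).
Earlier moves delete the countably many exceptional points, until Bob's ball lies where `φ` is
bi-Lipschitz at a fixed majority of places (`exists_winning_target`). Both games reduce to choosing
a point to be avoided at each move. -/

/-! ### Diophantine approximation: descent in height and rigidity of nearby approximations. -/

section Approximation

variable {K : Type*} [Field K] [NumberField K]

open NumberField.mixedEmbedding NumberField.InfinitePlace

/-- `x` has a rational approximation `-p / q` of height less than `H` and quality `c`. -/
def IsApproximable (x : mixedSpace K) (c H : ℝ) : Prop :=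
  ∃ p q : 𝓞 K, q ≠ 0 ∧ ∀ w : InfinitePlace K, w (q : K) < H ∧
    normAtPlace w (mixedEmbedding K (q : K) * x + mixedEmbedding K (p : K)) ≤ c / H

/-- `x` has an approximation as in `IsApproximable` whose denominator is large at the
place `v`. -/
def IsApproximableAt (x : mixedSpace K) (c η H : ℝ) (v : InfinitePlace K) : Prop :=
  ∃ p q : 𝓞 K, η * H < v (q : K) ∧ ∀ w : InfinitePlace K, w (q : K) < H ∧
    normAtPlace w (mixedEmbedding K (q : K) * x + mixedEmbedding K (p : K)) ≤ c / H

theorem normAtPlace_le_norm (x : mixedSpace K) (w : InfinitePlace K) : normAtPlace w x ≤ ‖x‖ := by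
  rw [norm_eq_sup'_normAtPlace]
  exact Finset.le_sup' (fun w ↦ normAtPlace w x) (Finset.mem_univ w)

omit [NumberField K] in
theorem normAtPlace_sub_le (w : InfinitePlace K) (x y : mixedSpace K) :
    normAtPlace w (x - y) ≤ normAtPlace w x + normAtPlace w y := by
  have := normAtPlace_add_le w x (-y)
  rwa [normAtPlace_neg, ← sub_eq_add_neg] at this

theorem exists_one_le_place {q : 𝓞 K} (hq : q ≠ 0) : ∃ w : InfinitePlace K, 1 ≤ w (q : K) := by
  by_contra! h
  obtain ⟨w⟩ : Nonempty (InfinitePlace K) := inferInstance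
  exact absurd (one_le_of_lt_one (w := w) hq fun z _ ↦ h z) (not_le.2 (h w))

theorem not_isApproximable_one (x : mixedSpace K) (c : ℝ) : ¬ IsApproximable x c 1 := by
  rintro ⟨p, q, hq, h⟩
  obtain ⟨w, hw⟩ := exists_one_le_place hq
  exact absurd (h w).1 (not_lt.2 hw)

/-- Rounding `‖q‖` up to a power of `G` costs at most a factor `G`, hence the constant `c / G`. -/
theorem mem_badlyApproximable_of_not_isApproximable {x : mixedSpace K} {c G : ℝ} (hc : 0 < c)
    (hG : 1 < G) (h : ∀ k : ℕ, ¬ IsApproximable x c (G ^ k)) : x ∈ badlyApproximable K := by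
  have hG0 : 0 < G := by linarith
  refine ⟨c / G, by positivity, fun p q hq ↦ ?_⟩
  set y := mixedEmbedding K (q : K) with hy
  have hy1 : 1 ≤ ‖y‖ := by
    obtain ⟨w, hw⟩ := exists_one_le_place hq
    have := normAtPlace_le_norm y w
    rw [hy, normAtPlace_apply] at this
    linarith
  obtain ⟨k, hk, hk'⟩ := exists_nat_pow_near hy1 hG
  have := h (k + 1)
  simp only [IsApproximable, not_exists, not_and, not_forall, not_le] at this
  obtain ⟨w, hw⟩ := this p q hq
  have h1 := hw (by
    have := normAtPlace_le_norm y w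
    rw [hy, normAtPlace_apply] at this
    linarith)
  refine lt_of_le_of_lt ?_ (h1.trans_le (normAtPlace_le_norm _ w))
  rw [pow_succ, mul_comm (G ^ k), ← div_div, ← div_eq_mul_inv]
  gcongr

/-- Minkowski's theorem for boxes that are long at a majority of the places. -/
theorem exists_integer_lt_of_majority (K : Type*) [Field K] [NumberField K] :
    ∃ G₀ : ℝ, ∀ G : ℝ, 1 < G → G₀ < G → ∀ T : Finset (InfinitePlace K),
      Module.finrank ℚ K < 2 * ∑ w ∈ T, mult w →
      ∃ a : 𝓞 K, a ≠ 0 ∧ ∀ w : InfinitePlace K, w (a : K) < if w ∈ T then G else G⁻¹ := by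
  have hM := minkowskiBound_lt_top K 1
  refine ⟨(minkowskiBound K 1).toReal, fun G hG hG₀ T hT ↦ ?_⟩
  have hG0 : 0 < G := by linarith
  set f : InfinitePlace K → NNReal :=
    fun w ↦ if w ∈ T then G.toNNReal else G.toNNReal⁻¹ with hf
  have hf' : ∀ w, (f w : ℝ) = if w ∈ T then G else G⁻¹ := by
    intro w
    simp only [hf]
    split_ifs <;> simp [hG0.le]
  -- The majority is strict and the exponents are integers, so at least one factor `G` survives; it
  -- alone beats the Minkowski bound.
  have key : G ≤ ∏ w : InfinitePlace K, (f w : ℝ) ^ mult w := by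
    have h1 : ∏ w : InfinitePlace K, (f w : ℝ) ^ mult w =
        G ^ (∑ w ∈ T, mult w) * (G ^ (∑ w ∈ Tᶜ, mult w))⁻¹ := by
      rw [← Finset.prod_mul_prod_compl T, ← Finset.prod_pow_eq_pow_sum,
        ← Finset.prod_pow_eq_pow_sum, ← Finset.prod_inv_distrib]
      congr 1
      · exact Finset.prod_congr rfl fun w hw ↦ by rw [hf', if_pos hw]
      · refine Finset.prod_congr rfl fun w hw ↦ ?_
        rw [hf', if_neg (Finset.mem_compl.1 hw), inv_pow]
    have h2 : ∑ w ∈ T, mult w + ∑ w ∈ Tᶜ, mult w = Module.finrank ℚ K := by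
      rw [Finset.sum_add_sum_compl, sum_mult_eq]
    rw [h1, ← div_eq_mul_inv, le_div_iff₀ (by positivity), ← pow_succ']
    exact pow_le_pow_right₀ hG.le (by omega)
  have hvol : minkowskiBound K ↑1 < MeasureTheory.volume (convexBodyLT K f) := by
    rw [convexBodyLT_volume]
    calc minkowskiBound K ↑1 = ENNReal.ofReal (minkowskiBound K 1).toReal :=
          (ENNReal.ofReal_toReal hM.ne).symm
      _ < ENNReal.ofReal G := (ENNReal.ofReal_lt_ofReal_iff hG0).2 hG₀
      _ ≤ ENNReal.ofReal (∏ w : InfinitePlace K, (f w : ℝ) ^ mult w) :=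
          ENNReal.ofReal_le_ofReal key
      _ = ((∏ w, f w ^ mult w : NNReal) : ENNReal) := by
          rw [← ENNReal.ofReal_coe_nnreal]; push_cast; rfl
      _ ≤ _ := by
          simp only [ENNReal.ofNNReal_finsetProd, ENNReal.coe_pow]
          exact le_mul_of_one_le_left zero_le
            (ENNReal.one_le_coe_iff.2 (one_le_convexBodyLTFactor K))
  obtain ⟨a, ha, h⟩ := exists_ne_zero_mem_ringOfIntegers_lt K hvol
  refine ⟨a, ha, fun w ↦ ?_⟩
  rw [← hf']
  exact h w

-- Multiply by `a`. Off `T` it lowers the height by `G`; on `T` it raises it by at most `G`,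
-- harmless if `q` is at most `H / G` there. The error grows by at most `G`, exactly what `c / (G *
-- H)` allows.
omit [NumberField K] in
theorem IsApproximable.descent {x : mixedSpace K} {c G H : ℝ} (hc : 0 < c) (hG : 1 < G)
    (hH : 0 < H) {T : Finset (InfinitePlace K)}
    (ha : ∃ a : 𝓞 K, a ≠ 0 ∧ ∀ w : InfinitePlace K, w (a : K) < if w ∈ T then G else G⁻¹)
    (h : IsApproximable x c (G * H)) :
    IsApproximable x c H ∨ ∃ v ∈ T, IsApproximableAt x c (G ^ 2)⁻¹ (G * H) v := by
  obtain ⟨p, q, hq, hpq⟩ := h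
  obtain ⟨a, ha0, ha⟩ := ha
  have hG0 : 0 < G := by linarith
  refine or_iff_not_imp_right.2 fun hv ↦ ?_
  push Not at hv
  have hT : ∀ w ∈ T, w (q : K) ≤ (G ^ 2)⁻¹ * (G * H) := fun w hw ↦ by
    by_contra! hlt
    exact hv w hw ⟨p, q, hlt, hpq⟩
  refine ⟨a * p, a * q, mul_ne_zero ha0 hq, fun w ↦ ?_⟩
  have haw := ha w
  have hqw := (hpq w).1
  have hxw := (hpq w).2
  have hq0 : 0 < w (q : K) := pos_iff.2 (by simpa using hq)
  set y := normAtPlace w (mixedEmbedding K (q : K) * x + mixedEmbedding K (p : K))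
  have hy : 0 ≤ y := normAtPlace_nonneg _ _
  have e : normAtPlace w (mixedEmbedding K ((a * q : 𝓞 K) : K) * x +
      mixedEmbedding K ((a * p : 𝓞 K) : K)) = w (a : K) * y := by
    rw [← normAtPlace_apply, ← map_mul]
    congr 1
    push_cast
    simp only [map_mul]
    ring
  rw [e]
  push_cast
  rw [map_mul]
  have hcH : G * (c / (G * H)) = c / H := by field_simp
  have hGy : w (a : K) * y ≤ G * (c / (G * H)) := by
    refine mul_le_mul (haw.le.trans ?_) hxw hy hG0.le
    split_ifs
    · exact le_rfl
    · exact (inv_lt_one_of_one_lt₀ hG).le.trans hG.le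
  refine ⟨?_, hcH ▸ hGy⟩
  by_cases hw : w ∈ T
  · rw [if_pos hw] at haw
    calc w (a : K) * w (q : K) < G * w (q : K) := by gcongr
      _ ≤ G * ((G ^ 2)⁻¹ * (G * H)) := by gcongr; exact hT w hw
      _ = H := by field_simp
  · rw [if_neg hw] at haw
    calc w (a : K) * w (q : K) < G⁻¹ * (G * H) := by gcongr
      _ = H := by field_simp

/-- Approximations of comparable height of nearby points are equal. -/
theorem mul_eq_mul_of_approximations {x x' : mixedSpace K} {c H δ : ℝ} (hH : 0 < H)
    {p q p' q' : 𝓞 K} (hx : ‖x' - x‖ ≤ δ) (hc : 2 * c + H ^ 2 * δ < 1)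
    (h : ∀ w : InfinitePlace K, w (q : K) < H ∧
      normAtPlace w (mixedEmbedding K (q : K) * x + mixedEmbedding K (p : K)) ≤ c / H)
    (h' : ∀ w : InfinitePlace K, w (q' : K) < H ∧
      normAtPlace w (mixedEmbedding K (q' : K) * x' + mixedEmbedding K (p' : K)) ≤ c / H) :
    p * q' = p' * q := by
  by_contra hne
  obtain ⟨w, hw⟩ := exists_one_le_place (sub_ne_zero.2 hne)
  -- The three terms have size at most `c`, `c` and `H ^ 2 * δ` at each place, too small in total
  -- for a nonzero integer.
  have e : mixedEmbedding K ((p * q' - p' * q : 𝓞 K) : K) =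
      mixedEmbedding K (q' : K) * (mixedEmbedding K (q : K) * x + mixedEmbedding K (p : K)) -
      mixedEmbedding K (q : K) * (mixedEmbedding K (q' : K) * x' + mixedEmbedding K (p' : K)) +
      mixedEmbedding K (q : K) * mixedEmbedding K (q' : K) * (x' - x) := by
    push_cast
    simp only [map_mul, map_sub]
    ring
  have b := normAtPlace_apply w ((p * q' - p' * q : 𝓞 K) : K)
  rw [e] at b
  have b1 := normAtPlace_add_le w
    (mixedEmbedding K (q' : K) * (mixedEmbedding K (q : K) * x + mixedEmbedding K (p : K)) -
      mixedEmbedding K (q : K) * (mixedEmbedding K (q' : K) * x' + mixedEmbedding K (p' : K)))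
    (mixedEmbedding K (q : K) * mixedEmbedding K (q' : K) * (x' - x))
  have b2 := normAtPlace_sub_le w
    (mixedEmbedding K (q' : K) * (mixedEmbedding K (q : K) * x + mixedEmbedding K (p : K)))
      (mixedEmbedding K (q : K) * (mixedEmbedding K (q' : K) * x' + mixedEmbedding K (p' : K)))
  simp only [map_mul, normAtPlace_apply] at b1 b2
  have nn := fun z ↦ normAtPlace_nonneg (K := K) w z
  have n1 : w (q' : K) * normAtPlace w
      (mixedEmbedding K (q : K) * x + mixedEmbedding K (p : K)) ≤ H * (c / H) :=
    mul_le_mul (h' w).1.le (h w).2 (nn _) hH.le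
  have n2 : w (q : K) * normAtPlace w
      (mixedEmbedding K (q' : K) * x' + mixedEmbedding K (p' : K)) ≤ H * (c / H) :=
    mul_le_mul (h w).1.le (h' w).2 (nn _) hH.le
  have n3 : w (q : K) * w (q' : K) * normAtPlace w (x' - x) ≤ H * H * δ :=
    mul_le_mul (mul_le_mul (h w).1.le (h' w).1.le (apply_nonneg _ _) hH.le)
      ((normAtPlace_le_norm _ w).trans hx) (nn _) (by positivity)
  have : H * (c / H) = c := by field_simp
  nlinarith

/-- Both points are close to the same quotient, and at `v` the errors may be divided by `q` and
`q'`, which exceed `η * H`. -/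
theorem IsApproximableAt.normAtPlace_sub_le {x x' : mixedSpace K} {c η H δ : ℝ}
    (hη : 0 < η) (hc0 : 0 < c) (hH : 0 < H) {v : InfinitePlace K}
    (hx : ‖x' - x‖ ≤ δ) (hc : 2 * c + H ^ 2 * δ < 1)
    (h : IsApproximableAt x c η H v) (h' : IsApproximableAt x' c η H v) :
    normAtPlace v (x' - x) ≤ 2 * c / (η * H ^ 2) := by
  obtain ⟨p, q, hq, h⟩ := h
  obtain ⟨p', q', hq', h'⟩ := h'
  have hpq := mul_eq_mul_of_approximations hH hx hc h h'
  have e : mixedEmbedding K (q : K) * mixedEmbedding K (q' : K) * (x' - x) =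
      mixedEmbedding K (q : K) * (mixedEmbedding K (q' : K) * x' + mixedEmbedding K (p' : K)) -
      mixedEmbedding K (q' : K) *
        (mixedEmbedding K (q : K) * x + mixedEmbedding K (p : K)) := by
    have : mixedEmbedding K (p : K) * mixedEmbedding K (q' : K) =
        mixedEmbedding K (p' : K) * mixedEmbedding K (q : K) := by
      simpa only [map_mul] using congrArg (fun z : 𝓞 K ↦ mixedEmbedding K (z : K)) hpq
    linear_combination this
  have b := _root_.normAtPlace_sub_le v
    (mixedEmbedding K (q : K) * (mixedEmbedding K (q' : K) * x' + mixedEmbedding K (p' : K)))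
    (mixedEmbedding K (q' : K) * (mixedEmbedding K (q : K) * x + mixedEmbedding K (p : K)))
  rw [← e] at b
  simp only [map_mul, normAtPlace_apply] at b
  have hηH : 0 < η * H := by positivity
  have q0 : 0 < v (q : K) := hηH.trans hq
  have q0' : 0 < v (q' : K) := hηH.trans hq'
  set D := normAtPlace v (x' - x)
  have hD : v (q : K) * v (q' : K) * D ≤ (v (q : K) + v (q' : K)) * (c / H) := by
    have n1 := mul_le_mul_of_nonneg_left (h' v).2 q0.le
    have n2 := mul_le_mul_of_nonneg_left (h v).2 q0'.le
    linarith
  have hD' : D ≤ (1 / v (q' : K) + 1 / v (q : K)) * (c / H) := by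
    have : (v (q : K) + v (q' : K)) * (c / H) =
        v (q : K) * v (q' : K) * ((1 / v (q' : K) + 1 / v (q : K)) * (c / H)) := by
      field_simp
    rw [this] at hD
    exact le_of_mul_le_mul_left hD (by positivity)
  calc D ≤ (1 / v (q' : K) + 1 / v (q : K)) * (c / H) := hD'
    _ ≤ (1 / (η * H) + 1 / (η * H)) * (c / H) := by gcongr
    _ = 2 * c / (η * H ^ 2) := by field_simp; ring

end Approximation

/-! ### A game on the interval in which Alice names a point to avoid. -/

section IntervalGame

open Filter Topology

/-- Consecutive moves of Bob obey the rules common to the games on `Y`, and whenever Bob's radius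
is at most `1 / 2`, his next ball misses the `β r`-neighbourhood of the point `τ` chosen by
Alice. -/
def IsTargetPlay (Y : Set ℝ) (β : ℝ) (τ : List (ℝ × ℝ) → ℝ) (B : ℕ → ℝ × ℝ) : Prop :=
  (∀ n, (B n).1 ∈ Y ∧ 0 < (B n).2) ∧ ∀ n, β * (B n).2 ≤ (B (n + 1)).2 ∧
    FormalLE (B (n + 1)) (B n) ∧
    ((B n).2 ≤ 1 / 2 → β * (B n).2 + (B (n + 1)).2 < dist (B (n + 1)).1 (τ (history B n)))

theorem history_succ {X : Type*} [MetricSpace X] (B : ℕ → X × ℝ) (n : ℕ) :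
    history B (n + 1) = history B n ++ [B (n + 1)] := by
  simp [history, List.range_succ]

theorem getLastD_history {X : Type*} [MetricSpace X] (B : ℕ → X × ℝ) (n : ℕ) (b : X × ℝ) :
    (history B n).getLastD b = B n := by
  simp [history, List.range_succ]

theorem length_history {X : Type*} [MetricSpace X] (B : ℕ → X × ℝ) (n : ℕ) :
    (history B n).length = n + 1 := by
  simp [history]

theorem FormalLE.trans {X : Type*} [MetricSpace X] {a b c : X × ℝ} (h : FormalLE a b)
    (h' : FormalLE b c) : FormalLE a c := by
  have := dist_triangle a.1 b.1 c.1
  unfold FormalLE at *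
  linarith

theorem FormalLE.radius_le {X : Type*} [MetricSpace X] {a b : X × ℝ} (h : FormalLE a b) :
    a.2 ≤ b.2 := by
  have := dist_nonneg.trans h
  linarith

theorem formalLE_of_le {X : Type*} [MetricSpace X] {B : ℕ → X × ℝ}
    (h : ∀ n, FormalLE (B (n + 1)) (B n)) {m n : ℕ} (hmn : m ≤ n) : FormalLE (B n) (B m) := by
  induction n, hmn using Nat.le_induction with
  | base => simp [FormalLE]
  | succ n _ ih => exact (h n).trans ih

theorem FormalLE.closedBall_subset {X : Type*} [MetricSpace X] {a b : X × ℝ} (h : FormalLE a b) :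
    Metric.closedBall a.1 a.2 ⊆ Metric.closedBall b.1 b.2 :=
  Metric.closedBall_subset_closedBall' (by unfold FormalLE at h; linarith)

/-- In a half-unit ball there is room to avoid any given point. -/
theorem exists_center_far {c r β : ℝ} (x : ℝ) (hc : c ∈ Icc (0 : ℝ) 1) (hr : 0 < r)
    (hr' : r ≤ 1 / 2) (hβ : 0 < β) (hβ' : β < 1 / 5) :
    ∃ c' ∈ Icc (0 : ℝ) 1, dist c' c ≤ (1 - β) * r ∧ 2 * β * r < dist c' x := by
  by_cases h : 2 * β * r < dist c x
  · exact ⟨c, hc, by rw [dist_self]; exact mul_nonneg (by linarith) hr.le, h⟩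
  -- Now `x` is within `2 * β * r` of `c`, and `1 - 3 * β > 2 * β` because `β < 1 / 5`.
  have key : ∀ c', dist c' c = (1 - β) * r → 2 * β * r < dist c' x := fun c' hc' ↦ by
    have := dist_triangle_right c' c x
    nlinarith
  obtain ⟨h0, h1⟩ := hc
  rcases le_total c (1 / 2) with hc | hc
  · have : dist (c + (1 - β) * r) c = (1 - β) * r := by
      rw [Real.dist_eq, add_sub_cancel_left, abs_of_nonneg]
      exact mul_nonneg (by linarith) hr.le
    exact ⟨c + (1 - β) * r, ⟨by nlinarith, by nlinarith⟩, this.le, key _ this⟩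
  · have : dist (c - (1 - β) * r) c = (1 - β) * r := by
      rw [dist_comm, Real.dist_eq, sub_sub_cancel, abs_of_nonneg]
      exact mul_nonneg (by linarith) hr.le
    exact ⟨c - (1 - β) * r, ⟨by nlinarith, by nlinarith⟩, this.le, key _ this⟩

/-- Bob can play with radii that decrease geometrically. -/
theorem exists_isTargetPlay {β : ℝ} (hβ : 0 < β) (hβ' : β < 1 / 5) (τ : List (ℝ × ℝ) → ℝ)
    {b : ℝ × ℝ} (hb : b.1 ∈ Icc (0 : ℝ) 1) (hr : 0 < b.2) (hr' : b.2 ≤ 1 / 2) :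
    ∃ B : ℕ → ℝ × ℝ, B 0 = b ∧ IsTargetPlay (Icc 0 1) β τ B ∧
      Tendsto (fun n ↦ (B n).2) atTop (𝓝 0) := by
  have step : ∀ h : List (ℝ × ℝ), ∃ b' : ℝ × ℝ, (h.getLastD b).1 ∈ Icc (0 : ℝ) 1 →
      0 < (h.getLastD b).2 → (h.getLastD b).2 ≤ 1 / 2 →
      b'.1 ∈ Icc (0 : ℝ) 1 ∧ dist b'.1 (h.getLastD b).1 ≤ (1 - β) * (h.getLastD b).2 ∧
      2 * β * (h.getLastD b).2 < dist b'.1 (τ h) ∧ b'.2 = β * (h.getLastD b).2 := by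
    intro h
    by_cases hh : (h.getLastD b).1 ∈ Icc (0 : ℝ) 1 ∧ 0 < (h.getLastD b).2 ∧
        (h.getLastD b).2 ≤ 1 / 2
    · obtain ⟨c', h1, h2, h3⟩ := exists_center_far (τ h) hh.1 hh.2.1 hh.2.2 hβ hβ'
      exact ⟨(c', β * (h.getLastD b).2), fun _ _ _ ↦ ⟨h1, h2, h3, rfl⟩⟩
    · exact ⟨b, fun a1 a2 a3 ↦ absurd ⟨a1, a2, a3⟩ hh⟩
  choose next hnext using step
  let hist : ℕ → List (ℝ × ℝ) := fun n ↦ Nat.rec [b] (fun _ h ↦ h ++ [next h]) n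
  let B : ℕ → ℝ × ℝ := fun n ↦ (hist n).getLastD b
  have hist_succ : ∀ n, hist (n + 1) = hist n ++ [next (hist n)] := fun n ↦ rfl
  have hB0 : B 0 = b := rfl
  have hBs : ∀ n, B (n + 1) = next (hist n) := fun n ↦ by simp [B, hist_succ]
  have hhist : ∀ n, history B n = hist n := by
    intro n
    induction n with
    | zero => rfl
    | succ n ih => rw [history_succ, ih, hist_succ, hBs]
  have inv : ∀ n, (B n).1 ∈ Icc (0 : ℝ) 1 ∧ (B n).2 = β ^ n * b.2 := by
    intro n
    induction n with
    | zero => simpa [hB0] using hb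
    | succ n ih =>
      have hp : 0 < (B n).2 := by rw [ih.2]; positivity
      have hq : (B n).2 ≤ 1 / 2 := by
        rw [ih.2]
        exact (mul_le_of_le_one_left hr.le (pow_le_one₀ hβ.le (by linarith))).trans hr'
      have := hnext (hist n) ih.1 hp hq
      rw [← hBs] at this
      refine ⟨this.1, ?_⟩
      rw [this.2.2.2, show (hist n).getLastD b = B n from rfl, ih.2, pow_succ']
      ring
  have pos : ∀ n, 0 < (B n).2 := fun n ↦ by rw [(inv n).2]; positivity
  refine ⟨B, hB0, ⟨fun n ↦ ⟨(inv n).1, pos n⟩, fun n ↦ ?_⟩, ?_⟩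
  · have hq : (B n).2 ≤ 1 / 2 := by
      rw [(inv n).2]
      exact (mul_le_of_le_one_left hr.le (pow_le_one₀ hβ.le (by linarith))).trans hr'
    have := hnext (hist n) (inv n).1 (pos n) hq
    rw [← hBs] at this
    obtain ⟨h1, h2, h3, h4⟩ := this
    rw [show (hist n).getLastD b = B n from rfl] at h2 h3 h4
    refine ⟨h4.ge, ?_, fun _ ↦ ?_⟩
    · unfold FormalLE
      linarith
    · rw [hhist]
      linarith
  · simp_rw [fun n ↦ (inv n).2]
    simpa using (tendsto_pow_atTop_nhds_zero_of_lt_one hβ.le (by linarith)).mul_const b.2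

/-- A point of an obstacle at the scale of the ball `b`, if `b` meets such an obstacle. -/
noncomputable def obstacleTarget {ι : Type*} (A ρ : ℝ) (O : ℕ → ι → Set ℝ) (b : ℝ × ℝ) : ℝ :=
  if h : ∃ t k v, ρ / A ^ (k + 1) < b.2 ∧ b.2 ≤ ρ / A ^ k ∧ t ∈ O k v ∧ dist t b.1 ≤ b.2
  then h.choose else 0

/-- The radius windows of different scales are disjoint, so the scale chosen in `obstacleTarget` can
only be `k`. -/
theorem obstacleTarget_mem {ι : Type*} {A ρ : ℝ} (hA : 1 < A) (hρ : 0 < ρ)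
    {O : ℕ → ι → Set ℝ} {b : ℝ × ℝ} {x : ℝ} {k : ℕ} {v : ι} (h₁ : ρ / A ^ (k + 1) < b.2)
    (h₂ : b.2 ≤ ρ / A ^ k) (hx : x ∈ O k v) (hxb : dist x b.1 ≤ b.2) :
    ∃ u, obstacleTarget A ρ O b ∈ O k u ∧ dist (obstacleTarget A ρ O b) b.1 ≤ b.2 := by
  have h : ∃ t k v, ρ / A ^ (k + 1) < b.2 ∧ b.2 ≤ ρ / A ^ k ∧ t ∈ O k v ∧ dist t b.1 ≤ b.2 :=
    ⟨x, k, v, h₁, h₂, hx, hxb⟩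
  rw [obstacleTarget, dif_pos h]
  obtain ⟨k', u, h₁', h₂', hu, hd⟩ := h.choose_spec
  have aux : ∀ {i j : ℕ}, ρ / A ^ (i + 1) < b.2 → b.2 ≤ ρ / A ^ j → j ≤ i := by
    intro i j hi hj
    by_contra! hlt
    have : ρ / A ^ j ≤ ρ / A ^ (i + 1) := by
      gcongr
      · exact hA.le
      · exact hlt
    linarith
  obtain rfl : k' = k := le_antisymm (aux h₁ h₂') (aux h₁' h₂)
  exact ⟨u, hu, hd⟩

/-- If at each scale there are boundedly many obstacles, each of them short, then a
player who deletes them one at a time avoids them all. -/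
theorem not_mem_obstacle {ι : Type*} [Fintype ι] {β A ρ : ℝ} (hβ : 0 < β) (hA : 1 < A)
    (hβA : A⁻¹ ≤ β ^ (Fintype.card ι + 1)) (hρ : 0 < ρ) {O : ℕ → ι → Set ℝ}
    (hO : ∀ k v, ∀ s ∈ O k v, ∀ t ∈ O k v, dist s t ≤ 2 * (ρ / A ^ k) →
      dist s t ≤ β * (ρ / A ^ (k + 1)))
    {B : ℕ → ℝ × ℝ} (h0 : ρ ≤ (B 0).2)
    (hB : ∀ n, β * (B n).2 ≤ (B (n + 1)).2 ∧ FormalLE (B (n + 1)) (B n) ∧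
      β * (B n).2 + (B (n + 1)).2 < dist (B (n + 1)).1 (obstacleTarget A ρ O (B n)))
    (hlim : Tendsto (fun n ↦ (B n).2) atTop (𝓝 0)) {x : ℝ}
    (hx : ∀ n, dist x (B n).1 ≤ (B n).2) (k : ℕ) (v : ι) : x ∉ O (k + 1) v := by
  intro hxO
  have hA0 : 0 < A := by linarith
  set R := ρ / A ^ (k + 1) with hR
  have hR0 : 0 < R := by positivity
  have hRA : ρ / A ^ (k + 1 + 1) = A⁻¹ * R := by rw [hR, pow_succ A (k + 1)]; field_simp
  have ex : ∃ n, (B n).2 ≤ R :=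
    ((hlim.eventually (gt_mem_nhds hR0)).exists).imp fun _ h ↦ le_of_lt h
  set m := Nat.find ex with hm
  have hmR : (B m).2 ≤ R := Nat.find_spec ex
  -- Bob starts at radius at least `ρ`, above every scale `k + 1`; this is why `O 0` is never
  -- treated.
  have hm0 : m ≠ 0 := by
    intro h
    rw [h] at hmR
    have : R < ρ := div_lt_self hρ (one_lt_pow₀ hA (by omega))
    linarith
  obtain ⟨l, hl⟩ := Nat.exists_eq_succ_of_ne_zero hm0
  have hlR : R < (B l).2 := by
    have := Nat.find_min ex (m := l) (by omega)
    linarith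
  have hmR' : β * R < (B m).2 := by
    rw [hl]
    exact (mul_lt_mul_of_pos_left hlR hβ).trans_le (hB l).1
  have lower : ∀ j, β ^ (j + 1) * R < (B (m + j)).2 := by
    intro j
    induction j with
    | zero => simpa using hmR'
    | succ j ih =>
      calc β ^ (j + 1 + 1) * R = β * (β ^ (j + 1) * R) := by ring
        _ < β * (B (m + j)).2 := by gcongr
        _ ≤ _ := (hB (m + j)).1
  have mono : ∀ {i j}, i ≤ j → FormalLE (B j) (B i) := fun h ↦
    formalLE_of_le (fun n ↦ (hB n).2.1) h
  have hβ1 : β ≤ 1 := by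
    have h1 := (hB l).1
    have h2 := (hB l).2.1.radius_le
    by_contra! hlt
    nlinarith
  -- Each move shrinks the radius by at most `β`, so Bob spends one more move at this scale than
  -- there are indices.
  have scale : ∀ j ≤ Fintype.card ι, ρ / A ^ (k + 1 + 1) < (B (m + j)).2 ∧
      (B (m + j)).2 ≤ ρ / A ^ (k + 1) := fun j hj ↦ by
    refine ⟨lt_of_le_of_lt ?_ (lower j), (mono (Nat.le_add_right m j)).radius_le.trans hmR⟩
    rw [hRA]
    gcongr
    exact hβA.trans (pow_le_pow_of_le_one hβ.le hβ1 (by omega))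
  have pick : ∀ j : Fin (Fintype.card ι + 1), ∃ u,
      obstacleTarget A ρ O (B (m + j)) ∈ O (k + 1) u ∧
      dist (obstacleTarget A ρ O (B (m + j))) (B (m + j)).1 ≤ (B (m + j)).2 := fun j ↦
    obstacleTarget_mem hA hρ (scale j (by omega)).1 (scale j (by omega)).2 hxO (hx _)
  choose u hu hud using pick
  -- Two targets in one obstacle would be within `β` times the radius at move `m + i`; but the later
  -- target lies in the next ball, which avoids that neighbourhood of the earlier one.
  have main : ∀ i j, i < j → u i ≠ u j := by
    intro i j hij he
    have hle : m + (i : ℕ) + 1 ≤ m + (j : ℕ) := by have : (i : ℕ) < j := hij; omega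
    set s := obstacleTarget A ρ O (B (m + i)) with hs
    set t := obstacleTarget A ρ O (B (m + j)) with ht
    have htb : dist t (B (m + i + 1)).1 ≤ (B (m + i + 1)).2 :=
      (mono hle).closedBall_subset (hud j)
    have htb' : dist t (B (m + i)).1 ≤ (B (m + i)).2 :=
      (mono ((Nat.le_succ _).trans hle)).closedBall_subset (hud j)
    have h1 : dist s t ≤ 2 * (ρ / A ^ (k + 1)) := by
      have h1 := dist_triangle_right s t (B (m + i)).1
      have h2 := hud i
      have h3 := (scale i (by omega)).2
      linarith
    have h2 := hO (k + 1) (u i) s (hu i) t (he ▸ hu j) h1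
    have h3 := (hB (m + i)).2.2
    have h4 := dist_triangle_left (B (m + i + 1)).1 s t
    have h5 : β * (ρ / A ^ (k + 1 + 1)) ≤ β * (B (m + i)).2 := by
      gcongr
      exact (scale i (by omega)).1.le
    rw [dist_comm s t] at h2
    linarith
  obtain ⟨i, j, hij, he⟩ := Fintype.exists_ne_map_eq_of_card_lt u (by simp)
  rcases lt_or_gt_of_ne hij with h | h
  · exact main i j h he
  · exact main j i h he.symm

/-- Alice wins if, locally outside of a countable set, the target set contains all
points that avoid a system of short obstacles. -/
theorem exists_winning_target {ι : Type*} [Fintype ι] {Y W E : Set ℝ} (hY : IsClosed Y)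
    (hE : E.Countable) {β A : ℝ} (hβ : 0 < β) (hA : 1 < A)
    (hβA : A⁻¹ ≤ β ^ (Fintype.card ι + 1)) {Loc : Set ℝ → Prop}
    (hmono : ∀ U V, U ⊆ V → Loc V → Loc U) (hloc : ∀ x ∈ Y, x ∉ E → ∃ V ∈ 𝓝[Y] x, Loc V)
    (hW : ∀ V, Loc V → ∀ R > 0, ∃ ρ > 0, ρ ≤ R ∧ ∃ O : ℕ → ι → Set ℝ,
      (∀ k v, ∀ s ∈ O k v, ∀ t ∈ O k v, dist s t ≤ 2 * (ρ / A ^ k) →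
        dist s t ≤ β * (ρ / A ^ (k + 1))) ∧
      ∀ x ∈ V, (∀ k v, x ∉ O (k + 1) v) → x ∈ W) :
    ∃ τ : List (ℝ × ℝ) → ℝ, ∀ B, IsTargetPlay Y β τ B →
      Tendsto (fun n ↦ (B n).2) atTop (𝓝 0) →
      ∃ x ∈ W ∩ Y, ∀ n, x ∈ Metric.closedBall (B n).1 (B n).2 := by
  obtain ⟨e, he⟩ := (countable_iff_exists_subset_range).1 hE
  let Good : ℝ × ℝ → Prop := fun b ↦
    0 < b.2 ∧ b.2 ≤ 1 / 2 ∧ Loc (Metric.closedBall b.1 b.2 ∩ Y)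
  have data : ∀ b, ∃ ρ : ℝ, ∃ O : ℕ → ι → Set ℝ, Good b → 0 < ρ ∧ ρ ≤ b.2 ∧
      (∀ k v, ∀ s ∈ O k v, ∀ t ∈ O k v, dist s t ≤ 2 * (ρ / A ^ k) →
        dist s t ≤ β * (ρ / A ^ (k + 1))) ∧
      ∀ x ∈ Metric.closedBall b.1 b.2 ∩ Y, (∀ k v, x ∉ O (k + 1) v) → x ∈ W := fun b ↦ by
    by_cases hb : Good b
    · obtain ⟨ρ, h1, h2, O, h3, h4⟩ := hW _ hb.2.2 b.2 hb.1
      exact ⟨ρ, O, fun _ ↦ ⟨h1, h2, h3, h4⟩⟩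
    · exact ⟨0, fun _ _ ↦ ∅, fun h ↦ absurd h hb⟩
  choose ρ O hρO using data
  -- The first good ball fixes the obstacle system for the rest of the play. Before it, unpairing
  -- the move number names every `e i` infinitely often.
  refine ⟨fun h ↦ match h.find? (fun b ↦ decide (Good b)) with
    | some b => obstacleTarget A (ρ b) (O b) (h.getLastD (0, 0))
    | none => e (h.length - 1).unpair.1, fun B hB hlim ↦ ?_⟩
  have mono : ∀ {i j}, i ≤ j → FormalLE (B j) (B i) := fun h ↦
    formalLE_of_le (fun n ↦ (hB.2 n).2.1) h
  obtain ⟨x, hx⟩ : ∃ x, ∀ n, x ∈ Metric.closedBall (B n).1 (B n).2 := by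
    have := IsCompact.nonempty_iInter_of_sequence_nonempty_isCompact_isClosed
      (fun n ↦ Metric.closedBall (B n).1 (B n).2)
      (fun n ↦ (mono n.le_succ).closedBall_subset)
      (fun n ↦ Metric.nonempty_closedBall.2 (hB.1 n).2.le) (isCompact_closedBall _ _)
      (fun n ↦ Metric.isClosed_closedBall)
    exact this.imp fun x hx n ↦ mem_iInter.1 hx n
  have hcx : Tendsto (fun n ↦ (B n).1) atTop (𝓝 x) := by
    rw [tendsto_iff_dist_tendsto_zero]
    exact squeeze_zero (fun _ ↦ dist_nonneg)
      (fun n ↦ by rw [dist_comm]; exact hx n) hlim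
  have hxY : x ∈ Y := hY.mem_of_tendsto hcx (Eventually.of_forall fun n ↦ (hB.1 n).1)
  have half : ∃ N, ∀ n ≥ N, (B n).2 ≤ 1 / 2 :=
    eventually_atTop.1 ((hlim.eventually (gt_mem_nhds (by norm_num : (0 : ℝ) < 1 / 2))).mono
      fun _ h ↦ le_of_lt h)
  have hgood : ∃ n, Good (B n) := by
    by_contra! hbad
    have hfind : ∀ n, (history B n).find? (fun b ↦ decide (Good b)) = none := fun n ↦ by
      rw [List.find?_eq_none]
      intro b hb
      obtain ⟨i, -, rfl⟩ := List.mem_map.1 hb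
      simpa using hbad i
    have hxE : x ∉ E := fun hxE ↦ by
      obtain ⟨i, rfl⟩ := he hxE
      obtain ⟨N, hN⟩ := half
      -- Move `Nat.pair i N` targets `e i` and comes late enough for the radius to be at most `1 /
      -- 2`, when targets take effect.
      have h1 := (hB.2 (Nat.pair i N)).2.2 (hN _ (Nat.right_le_pair i N))
      simp only [hfind, length_history, Nat.add_sub_cancel, Nat.unpair_pair] at h1
      have h2 : dist (e i) (B (Nat.pair i N + 1)).1 ≤ _ := hx (Nat.pair i N + 1)
      rw [dist_comm] at h2
      have := mul_pos hβ (hB.1 (Nat.pair i N)).2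
      linarith
    obtain ⟨V, hV, hVL⟩ := hloc x hxY hxE
    obtain ⟨ε, hε, hεV⟩ := Metric.mem_nhdsWithin_iff.1 hV
    obtain ⟨N, hN⟩ := half
    obtain ⟨M, hM⟩ := eventually_atTop.1 (hlim.eventually (gt_mem_nhds (half_pos hε)))
    refine hbad (max N M) ⟨(hB.1 _).2, hN _ (le_max_left _ _), hmono _ _ ?_ hVL⟩
    rintro y ⟨hy, hyY⟩
    refine hεV ⟨?_, hyY⟩
    have h1 := dist_triangle_right y x (B (max N M)).1
    have h2 := hx (max N M)
    have h3 := hM _ (le_max_right N M)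
    rw [Metric.mem_closedBall] at hy h2
    rw [Metric.mem_ball]
    linarith
  set m := Nat.find hgood
  have hm : Good (B m) := Nat.find_spec hgood
  have hfind : ∀ n, (history B (m + n)).find? (fun b ↦ decide (Good b)) = some (B m) := by
    have base : (history B m).find? (fun b ↦ decide (Good b)) = some (B m) := by
      rw [history, List.range_succ, List.map_append, List.find?_append,
        List.find?_eq_none.2, Option.none_or]
      · simp [hm]
      · intro b hb
        obtain ⟨i, hi, rfl⟩ := List.mem_map.1 hb
        simpa using Nat.find_min hgood (List.mem_range.1 hi)
    intro n
    induction n with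
    | zero => exact base
    | succ n ih => rw [← add_assoc, history_succ, List.find?_append, ih, Option.some_or]
  obtain ⟨h1, h2, h3, h4⟩ := hρO _ hm
  refine ⟨x, ⟨h4 x ⟨hx m, hxY⟩ fun k v ↦ ?_, hxY⟩, hx⟩
  refine not_mem_obstacle (B := fun n ↦ B (m + n)) hβ hA hβA h1 h3 h2 (fun n ↦ ?_) ?_
    (fun n ↦ hx (m + n)) k v
  · obtain ⟨g1, g2, g3⟩ := hB.2 (m + n)
    refine ⟨g1, g2, ?_⟩
    have := g3 ((mono (Nat.le_add_right m n)).radius_le.trans hm.2.1)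
    simp only [hfind, getLastD_history] at this
    exact this
  · simpa only [add_comm m] using (tendsto_add_atTop_iff_nat m).2 hlim

end IntervalGame

/-! ### From the target game to the absolute game and Schmidt's game. -/

section Reductions

open Filter Topology

/-- Density of the target set, for plays whose radii do not tend to zero: let Bob start in the given
ball and play with shrinking radii. -/
theorem exists_mem_of_target {W : Set ℝ} {β : ℝ} (hβ : 0 < β) (hβ' : β < 1 / 5)
    {τ : List (ℝ × ℝ) → ℝ} (hτ : ∀ B, IsTargetPlay (Icc 0 1) β τ B →
      Tendsto (fun n ↦ (B n).2) atTop (𝓝 0) →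
      ∃ x ∈ W ∩ Icc (0 : ℝ) 1, ∀ n, x ∈ Metric.closedBall (B n).1 (B n).2)
    {c r : ℝ} (hc : c ∈ Icc (0 : ℝ) 1) (hr : 0 < r) :
    ∃ x ∈ W ∩ Icc (0 : ℝ) 1, x ∈ Metric.closedBall c r := by
  obtain ⟨B, hB0, hB, hlim⟩ := exists_isTargetPlay hβ hβ' τ (b := (c, min r (1 / 2))) hc
    (lt_min hr (by norm_num)) (min_le_right _ _)
  obtain ⟨x, hx, hxB⟩ := hτ B hB hlim
  refine ⟨x, hx, Metric.closedBall_subset_closedBall (min_le_left r (1 / 2)) ?_⟩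
  have := hxB 0
  rwa [hB0] at this

/-- A descending sequence of formal balls whose radii do not tend to zero contains a ball. -/
theorem exists_ball_of_not_tendsto {Y : Set ℝ} (hY : IsClosed Y) {B : ℕ → ℝ × ℝ}
    (hB : ∀ n, (B n).1 ∈ Y ∧ 0 < (B n).2) (hmono : ∀ n, FormalLE (B (n + 1)) (B n))
    (hlim : ¬ Tendsto (fun n ↦ (B n).2) atTop (𝓝 0)) :
    ∃ c ∈ Y, ∃ r > 0, ∀ n, FormalLE (c, r) (B n) := by
  have anti : Antitone fun n ↦ (B n).2 := antitone_nat_of_succ_le fun n ↦ (hmono n).radius_le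
  have bdd : BddBelow (range fun n ↦ (B n).2) := ⟨0, by rintro _ ⟨n, rfl⟩; exact (hB n).2.le⟩
  have hinf := tendsto_atTop_ciInf anti bdd
  set r := ⨅ n, (B n).2
  have hr : 0 < r := by
    refine lt_of_le_of_ne (le_ciInf fun n ↦ (hB n).2.le) fun h ↦ hlim ?_
    rwa [← h] at hinf
  have hle : ∀ n, r ≤ (B n).2 := fun n ↦ ciInf_le bdd n
  -- With the limit radius `r` subtracted the balls stay nested; a common centre leaves room for
  -- radius `r` in each.
  obtain ⟨c, hc⟩ := IsCompact.nonempty_iInter_of_sequence_nonempty_isCompact_isClosed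
    (fun n ↦ Metric.closedBall (B n).1 ((B n).2 - r) ∩ Y)
    (fun n ↦ inter_subset_inter_left _ (Metric.closedBall_subset_closedBall' (by
      have := hmono n
      unfold FormalLE at this
      linarith)))
    (fun n ↦ ⟨(B n).1, Metric.mem_closedBall_self (by linarith [hle n]), (hB n).1⟩)
    ((isCompact_closedBall _ _).inter_right hY) (fun n ↦ Metric.isClosed_closedBall.inter hY)
  rw [mem_iInter] at hc
  exact ⟨c, (hc 0).2, r, hr, fun n ↦ (hc n).1⟩

theorem isAbsoluteWinningWith_of_target {W : Set ℝ} {β : ℝ} (hβ : 0 < β) (hβ' : β < 1 / 5)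
    {τ : List (ℝ × ℝ) → ℝ} (hτ : ∀ B, IsTargetPlay (Icc 0 1) β τ B →
      Tendsto (fun n ↦ (B n).2) atTop (𝓝 0) →
      ∃ x ∈ W ∩ Icc (0 : ℝ) 1, ∀ n, x ∈ Metric.closedBall (B n).1 (B n).2) :
    IsAbsoluteWinningWith {L : Set ℝ | ∃ x : ℝ, L = {x}} β (Icc 0 1) W := by
  refine ⟨fun h ↦ (if (h.getLastD (0, 0)).2 ≤ 1 / 2 then {τ h}
    else {(h.getLastD (0, 0)).1 + 3 * (h.getLastD (0, 0)).2}, β * (h.getLastD (0, 0)).2),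
    fun B ↦ ⟨fun n hn ↦ ?_, fun hB ↦ ?_⟩⟩
  · simp only [getLastD_history]
    obtain ⟨hY, hpos⟩ : (B n).1 ∈ Icc (0 : ℝ) 1 ∧ 0 < (B n).2 := by
      rcases n with _ | n
      · exact ⟨hn.1, hn.2.1⟩
      · exact ⟨(hn.2.2 n n.lt_succ_self).1, (hn.2.2 n n.lt_succ_self).2.1⟩
    refine ⟨⟨?_, mul_pos hβ hpos, le_rfl⟩, ?_⟩
    · split_ifs
      exacts [⟨_, rfl⟩, ⟨_, rfl⟩]
    · split_ifs with hr
      · obtain ⟨c, hc, hd, hfar⟩ := exists_center_far (τ (history B n)) hY hpos hr hβ hβ'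
        refine ⟨(c, β * (B n).2), hc, mul_pos hβ hpos, le_rfl, by simp only; nlinarith, ?_, ?_⟩
        · unfold FormalLE
          simp only
          linarith
        · rw [Metric.infEDist_singleton, edist_dist]
          exact (ENNReal.ofReal_lt_ofReal_iff_of_nonneg (by positivity)).2
            (by simp only; linarith)
      -- For large balls Alice deletes around a point three radii from the centre, so Bob may repeat
      -- his ball.
      · refine ⟨B n, hY, hpos, by nlinarith, le_rfl, by simp [FormalLE], ?_⟩
        rw [Metric.infEDist_singleton, edist_dist]
        refine (ENNReal.ofReal_lt_ofReal_iff_of_nonneg (by positivity)).2 ?_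
        rw [Real.dist_eq, sub_add_cancel_left, abs_neg, abs_of_pos (by positivity)]
        simp only
        nlinarith
  · have next := fun n ↦ (hB (n + 1)).2.2 n n.lt_succ_self
    have hYpos : ∀ n, (B n).1 ∈ Icc (0 : ℝ) 1 ∧ 0 < (B n).2 := fun n ↦ by
      rcases n with _ | n
      · exact ⟨(hB 0).1, (hB 0).2.1⟩
      · exact ⟨(next n).1, (next n).2.1⟩
    by_cases hlim : Tendsto (fun n ↦ (B n).2) atTop (𝓝 0)
    · have hplay : IsTargetPlay (Icc 0 1) β τ B := by
        refine ⟨hYpos, fun n ↦ ?_⟩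
        obtain ⟨-, -, h1, -, h2, h3⟩ := next n
        refine ⟨h1, h2, fun hr ↦ ?_⟩
        simp only [getLastD_history, if_pos hr, Metric.infEDist_singleton, edist_dist] at h3
        exact (ENNReal.ofReal_lt_ofReal_iff_of_nonneg
          (add_nonneg (mul_nonneg hβ.le (hYpos n).2.le) (hYpos (n + 1)).2.le)).1 h3
      obtain ⟨x, hx, hxB⟩ := hτ B hplay hlim
      exact ⟨x, hx, mem_iInter.2 hxB⟩
    · obtain ⟨c, hc, r, hr, hcr⟩ := exists_ball_of_not_tendsto isClosed_Icc hYpos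
        (fun n ↦ (next n).2.2.2.2.1) hlim
      obtain ⟨x, hx, hxc⟩ := exists_mem_of_target hβ hβ' hτ hc hr
      exact ⟨x, hx, mem_iInter.2 fun n ↦ (hcr n).closedBall_subset hxc⟩

/-- When `r ≤ 1 / 2`, Alice centres her ball of radius `r / 6` more than `r / 3` from the target, so
Bob's reply misses its `r / 6`-neighbourhood. The value `1 / 6` is below the `1 / 5` of
`exists_center_far`. -/
theorem isSchmidtWinningWith_of_target {W : Set ℝ} {β : ℝ} (hβ : 0 < β) (hβ' : β < 1)
    {τ : List (ℝ × ℝ) → ℝ} (hτ : ∀ B, IsTargetPlay (Icc 0 1) (1 / 6 * β) τ B →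
      Tendsto (fun n ↦ (B n).2) atTop (𝓝 0) →
      ∃ x ∈ W ∩ Icc (0 : ℝ) 1, ∀ n, x ∈ Metric.closedBall (B n).1 (B n).2) :
    IsSchmidtWinningWith (1 / 6) β (Icc 0 1) W := by
  have answer : ∀ h : List (ℝ × ℝ), ∃ a : ℝ, (h.getLastD (0, 0)).1 ∈ Icc (0 : ℝ) 1 →
      0 < (h.getLastD (0, 0)).2 → a ∈ Icc (0 : ℝ) 1 ∧
      dist a (h.getLastD (0, 0)).1 ≤ (1 - 1 / 6) * (h.getLastD (0, 0)).2 ∧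
      ((h.getLastD (0, 0)).2 ≤ 1 / 2 →
        2 * (1 / 6) * (h.getLastD (0, 0)).2 < dist a (τ h)) := by
    intro h
    by_cases hh : (h.getLastD (0, 0)).1 ∈ Icc (0 : ℝ) 1 ∧ 0 < (h.getLastD (0, 0)).2
    · by_cases hr : (h.getLastD (0, 0)).2 ≤ 1 / 2
      · obtain ⟨a, h1, h2, h3⟩ := exists_center_far (τ h) hh.1 hh.2 hr
          (by norm_num : (0 : ℝ) < 1 / 6) (by norm_num)
        exact ⟨a, fun _ _ ↦ ⟨h1, h2, fun _ ↦ h3⟩⟩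
      · exact ⟨(h.getLastD (0, 0)).1, fun h1 h2 ↦
          ⟨h1, by rw [dist_self]; linarith, fun h3 ↦ absurd h3 hr⟩⟩
    · exact ⟨0, fun h1 h2 ↦ absurd ⟨h1, h2⟩ hh⟩
  choose a ha using answer
  refine ⟨fun h ↦ (a h, 1 / 6 * (h.getLastD (0, 0)).2), fun B ↦ ⟨fun n hn ↦ ?_, fun hB ↦ ?_⟩⟩
  · have hYpos : ∀ i ≤ n, (B i).1 ∈ Icc (0 : ℝ) 1 ∧ 0 < (B i).2 := by
      intro i
      induction i with
      | zero => exact fun _ ↦ ⟨hn.1, hn.2.1⟩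
      | succ i ih =>
        intro hi
        obtain ⟨h1, h2, -⟩ := hn.2.2 i hi
        simp only [getLastD_history] at h2
        have := (ih (by omega)).2
        exact ⟨h1, by rw [h2]; positivity⟩
    have := ha (history B n)
    simp only [getLastD_history] at this ⊢
    obtain ⟨h1, h2, -⟩ := this (hYpos n le_rfl).1 (hYpos n le_rfl).2
    refine ⟨h1, trivial, ?_⟩
    unfold FormalLE
    simp only
    linarith
  · have next := fun n ↦ (hB (n + 1)).2.2 n n.lt_succ_self
    simp only [getLastD_history] at next
    have hrad : ∀ n, (B n).2 = (1 / 6 * β) ^ n * (B 0).2 := by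
      intro n
      induction n with
      | zero => simp
      | succ n ih => rw [(next n).2.1, ih]; ring
    have hYpos : ∀ n, (B n).1 ∈ Icc (0 : ℝ) 1 ∧ 0 < (B n).2 := fun n ↦ by
      refine ⟨?_, by rw [hrad]; have := (hB 0).2.1; positivity⟩
      rcases n with _ | n
      · exact (hB 0).1
      · exact (next n).1
    have hlim : Tendsto (fun n ↦ (B n).2) atTop (𝓝 0) := by
      rw [funext hrad]
      simpa using (tendsto_pow_atTop_nhds_zero_of_lt_one (r := 1 / 6 * β) (by positivity)
        (by linarith)).mul_const (B 0).2
    have hplay : IsTargetPlay (Icc 0 1) (1 / 6 * β) τ B := by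
      refine ⟨hYpos, fun n ↦ ?_⟩
      have hA := ha (history B n)
      simp only [getLastD_history] at hA
      obtain ⟨-, h2, h3⟩ := hA (hYpos n).1 (hYpos n).2
      obtain ⟨-, h4, h5⟩ := next n
      have hp := (hYpos n).2
      refine ⟨by linarith, ?_, fun hr ↦ ?_⟩
      · refine h5.trans ?_
        unfold FormalLE
        simp only
        linarith
      · have h6 := h3 hr
        unfold FormalLE at h5
        simp only at h5
        have h7 := dist_triangle_left (a (history B n)) (τ (history B n)) (B (n + 1)).1
        have h8 : β * (B n).2 ≤ (B n).2 := mul_le_of_le_one_left hp.le hβ'.le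
        linarith
    obtain ⟨x, hx, hxB⟩ := hτ B hplay hlim
    exact ⟨x, hx, mem_iInter.2 hxB⟩

theorem winning_of_target {W : Set ℝ} (h : ∀ β : ℝ, 0 < β → β < 1 / 5 →
    ∃ τ : List (ℝ × ℝ) → ℝ, ∀ B, IsTargetPlay (Icc 0 1) β τ B →
      Tendsto (fun n ↦ (B n).2) atTop (𝓝 0) →
      ∃ x ∈ W ∩ Icc (0 : ℝ) 1, ∀ n, x ∈ Metric.closedBall (B n).1 (B n).2) :
    IsAbsoluteWinningOn (Icc 0 1) W ∧ IsSchmidtWinningOn (Icc 0 1) W := by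
  refine ⟨⟨1 / 5, by norm_num, by norm_num, fun β hβ hβ' ↦ ?_⟩,
    ⟨1 / 6, by norm_num, by norm_num, fun β hβ hβ' ↦ ?_⟩⟩
  · obtain ⟨τ, hτ⟩ := h β hβ hβ'
    exact isAbsoluteWinningWith_of_target hβ hβ' hτ
  · obtain ⟨τ, hτ⟩ := h (1 / 6 * β) (by positivity) (by linarith)
    exact isSchmidtWinningWith_of_target hβ hβ' hτ

end Reductions

/-! ### Bi-Lipschitz pieces of the curve and their obstacles. -/

section Curves

open Filter Topology NumberField.mixedEmbedding NumberField.InfinitePlace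

variable {K : Type*} [Field K] [NumberField K]

/-- The curve `φ` is bi-Lipschitz on `V` at a majority of the places. -/
def IsMajorityBilipschitzOn (φ : ℝ → mixedSpace K) (V : Set ℝ) : Prop :=
  ∃ T : Finset (InfinitePlace K), Module.finrank ℚ K < 2 * ∑ w ∈ T, mult w ∧
    ∃ l > 0, ∃ L > 0, ∀ s ∈ V, ∀ t ∈ V,
      (∀ w ∈ T, l * dist s t ≤ normAtPlace w (φ s - φ t)) ∧ ‖φ s - φ t‖ ≤ L * dist s t

theorem exists_finset_moving (φ : ℝ → mixedSpace K) (x : ℝ) :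
    ∃ T : Finset (InfinitePlace K), ∑ w ∈ T, mult w =
        (movingReal φ x).ncard + 2 * (movingComplex φ x).ncard ∧
      ∀ w ∈ T, 0 < normAtPlace w (derivWithin φ (Icc 0 1) x) := by
  have hR : ∀ w : {w : InfinitePlace K // w.IsReal}, mult w.1 = 1 := fun w ↦ by
    simp [mult, w.2]
  have hC : ∀ w : {w : InfinitePlace K // w.IsComplex}, mult w.1 = 2 := fun w ↦ by
    simp [mult, not_isReal_iff_isComplex.2 w.2]
  refine ⟨(movingReal φ x).toFinset.image Subtype.val ∪
    (movingComplex φ x).toFinset.image Subtype.val, ?_, fun w hw ↦ ?_⟩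
  · rw [Finset.sum_union, Finset.sum_image Subtype.val_injective.injOn,
      Finset.sum_image Subtype.val_injective.injOn]
    · simp only [hR, hC, Finset.sum_const, smul_eq_mul, mul_one, ncard_eq_toFinset_card']
      ring
    · rw [Finset.disjoint_left]
      intro w h1 h2
      obtain ⟨u, -, rfl⟩ := Finset.mem_image.1 h1
      obtain ⟨v, -, hv⟩ := Finset.mem_image.1 h2
      exact not_isReal_iff_isComplex.2 v.2 (hv ▸ u.2)
  · rcases Finset.mem_union.1 hw with h | h
    · obtain ⟨u, hu, rfl⟩ := Finset.mem_image.1 h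
      rw [normAtPlace_apply_of_isReal u.2]
      exact norm_pos_iff.2 (mem_toFinset.1 hu)
    · obtain ⟨u, hu, rfl⟩ := Finset.mem_image.1 h
      rw [normAtPlace_apply_of_isComplex u.2]
      exact norm_pos_iff.2 (mem_toFinset.1 hu)

/-- Subtract the linear map `t • D`, with `D` the derivative at `x`. By continuity the remainder is
`l`-Lipschitz near `x`, while `D` has size at least `2 * l` at each place of `T`. -/
theorem exists_nhds_isMajorityBilipschitzOn {φ : ℝ → mixedSpace K}
    (hφ : ContDiffOn ℝ 1 φ (Icc 0 1)) {x : ℝ} (hx : x ∈ Icc (0 : ℝ) 1)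
    (hT : (Module.finrank ℚ K : ℝ) / 2 <
      ((movingReal φ x).ncard : ℝ) + 2 * ((movingComplex φ x).ncard : ℝ)) :
    ∃ V ∈ 𝓝[Icc 0 1] x, IsMajorityBilipschitzOn φ V := by
  obtain ⟨T, hsum, hpos⟩ := exists_finset_moving φ x
  set D := derivWithin φ (Icc 0 1) x with hD
  obtain ⟨l, hl, hl0⟩ : ∃ l, (∀ w ∈ T, 2 * l ≤ normAtPlace w D) ∧ 0 < l := by
    refine (((eventually_all_finset T).2 fun w hw ↦ ?_).and
      (self_mem_nhdsWithin : ∀ᶠ l in 𝓝[>] (0 : ℝ), 0 < l)).exists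
    filter_upwards [nhdsWithin_le_nhds (gt_mem_nhds (half_pos (hpos w hw)))] with l hl
    linarith
  have hu : UniqueDiffOn ℝ (Icc (0 : ℝ) 1) := uniqueDiffOn_Icc zero_lt_one
  have hcont := (hφ.continuousOn_derivWithin hu le_rfl) x hx
  obtain ⟨δ, hδ, hball⟩ := Metric.mem_nhdsWithin_iff.1
    (hcont (Metric.closedBall_mem_nhds D hl0))
  refine ⟨Metric.ball x δ ∩ Icc 0 1, inter_comm (Icc (0 : ℝ) 1) _ ▸
    inter_mem_nhdsWithin _ (Metric.ball_mem_nhds x hδ), T, ?_, l, hl0, l + ‖D‖,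
    by positivity, fun s hs t ht ↦ ?_⟩
  · rw [hsum]
    rw [div_lt_iff₀ two_pos] at hT
    exact_mod_cast (by linarith : (Module.finrank ℚ K : ℝ) < 2 *
      (((movingReal φ x).ncard : ℝ) + 2 * ((movingComplex φ x).ncard : ℝ)))
  have hder : ∀ y ∈ Metric.ball x δ ∩ Icc 0 1, HasDerivWithinAt (fun t ↦ φ t - t • D)
      (derivWithin φ (Icc 0 1) y - (1 : ℝ) • D) (Metric.ball x δ ∩ Icc 0 1) y := fun y hy ↦
    ((hφ.differentiableOn one_ne_zero y hy.2).hasDerivWithinAt.mono inter_subset_right).sub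
      ((hasDerivWithinAt_id y _).smul_const D)
  have hmv := Convex.norm_image_sub_le_of_norm_hasDerivWithin_le (C := l) hder
    (fun y hy ↦ by simpa [dist_eq_norm] using hball hy)
    ((convex_ball x δ).inter (convex_Icc 0 1)) ht hs
  have e : φ s - φ t = (φ s - s • D - (φ t - t • D)) + (s - t) • D := by
    rw [sub_smul]; abel
  rw [Real.norm_eq_abs, ← Real.dist_eq] at hmv
  refine ⟨fun w hw ↦ ?_, ?_⟩
  · have h1 := normAtPlace_sub_le w (φ s - φ t) (φ s - s • D - (φ t - t • D))
    rw [show φ s - φ t - (φ s - s • D - (φ t - t • D)) = (s - t) • D by rw [sub_smul]; abel,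
      normAtPlace_smul, ← Real.dist_eq] at h1
    have h2 := (normAtPlace_le_norm _ w).trans hmv
    have h3 := mul_le_mul_of_nonneg_left (hl w hw) (dist_nonneg (x := s) (y := t))
    linarith
  · rw [e]
    refine (norm_add_le _ _).trans ?_
    rw [_root_.norm_smul, Real.norm_eq_abs, ← Real.dist_eq, add_mul, mul_comm ‖D‖]
    linarith

/-- On a bi-Lipschitz piece of a curve, the points that are well approximable at given
scales form short obstacles, and the points that avoid these are badly approximable. -/
theorem IsMajorityBilipschitzOn.exists_obstacles {φ : ℝ → mixedSpace K} {V : Set ℝ}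
    (hV : IsMajorityBilipschitzOn φ V) {β G : ℝ} (hβ : 0 < β) (hG : 1 < G)
    (hmink : ∀ T : Finset (InfinitePlace K), Module.finrank ℚ K < 2 * ∑ w ∈ T, mult w →
      ∃ a : 𝓞 K, a ≠ 0 ∧ ∀ w : InfinitePlace K, w (a : K) < if w ∈ T then G else G⁻¹)
    {R : ℝ} (hR : 0 < R) :
    ∃ ρ > 0, ρ ≤ R ∧ ∃ O : ℕ → InfinitePlace K → Set ℝ,
      (∀ k v, ∀ s ∈ O k v, ∀ t ∈ O k v, dist s t ≤ 2 * (ρ / (G ^ 2) ^ k) →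
        dist s t ≤ β * (ρ / (G ^ 2) ^ (k + 1))) ∧
      ∀ x ∈ V, (∀ k v, x ∉ O (k + 1) v) → x ∈ φ ⁻¹' badlyApproximable K := by
  obtain ⟨T, hT, l, hl, L, hL, hlip⟩ := hV
  have hG0 : 0 < G := by linarith
  -- With `c ≤ 1 / 8` this gives `2 * c + 2 * L * ρ < 1`, as rigidity requires.
  set ρ := min R (1 / (4 * L)) with hρ
  have hρ0 : 0 < ρ := lt_min hR (by positivity)
  have hρL : L * ρ ≤ 1 / 4 := by
    calc L * ρ ≤ L * (1 / (4 * L)) := by gcongr; exact min_le_right _ _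
      _ = 1 / 4 := by field_simp
  -- One `G ^ 2` pays for the denominator bound `(G ^ 2)⁻¹`, the other for passing to the next
  -- scale.
  set c := min (1 / 8) (l * β * ρ / (2 * G ^ 4)) with hc
  have hc0 : 0 < c := lt_min (by norm_num) (by positivity)
  have hc8 : c ≤ 1 / 8 := min_le_left _ _
  have hcl : c ≤ l * β * ρ / (2 * G ^ 4) := min_le_right _ _
  refine ⟨ρ, hρ0, min_le_left _ _, fun k v ↦ {t | t ∈ V ∧ v ∈ T ∧
    IsApproximableAt (φ t) c (G ^ 2)⁻¹ (G ^ k) v}, ?_, fun x hx hxO ↦ ?_⟩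
  · rintro k v s ⟨hs, hv, hsa⟩ t ⟨ht, -, hta⟩ hst
    have hGk : 0 < G ^ k := by positivity
    have hpow : (G ^ 2) ^ k = (G ^ k) ^ 2 := by rw [← pow_mul, ← pow_mul, mul_comm]
    rw [hpow] at hst
    rw [pow_succ (G ^ 2), hpow]
    have h1 : ‖φ s - φ t‖ ≤ L * (2 * (ρ / (G ^ k) ^ 2)) :=
      (hlip s hs t ht).2.trans (by gcongr)
    have h2 : (G ^ k) ^ 2 * (L * (2 * (ρ / (G ^ k) ^ 2))) = 2 * (L * ρ) := by field_simp
    have h3 := IsApproximableAt.normAtPlace_sub_le (by positivity) hc0 hGk h1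
      (by rw [h2]; linarith) hta hsa
    have h4 := ((hlip s hs t ht).1 v hv).trans h3
    refine le_of_mul_le_mul_left (h4.trans ?_) hl
    calc 2 * c / ((G ^ 2)⁻¹ * (G ^ k) ^ 2)
        ≤ 2 * (l * β * ρ / (2 * G ^ 4)) / ((G ^ 2)⁻¹ * (G ^ k) ^ 2) := by gcongr
      _ = l * (β * (ρ / ((G ^ k) ^ 2 * G ^ 2))) := by field_simp
  · refine mem_badlyApproximable_of_not_isApproximable hc0 hG fun k ↦ ?_
    induction k with
    | zero => simpa using not_isApproximable_one (φ x) c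
    | succ k ih =>
      intro h
      rw [pow_succ'] at h
      rcases h.descent hc0 hG (by positivity) (hmink T hT) with h | ⟨v, hv, h⟩
      · exact ih h
      · rw [← pow_succ'] at h
        exact hxO k v ⟨hx, hv, h⟩

end Curves

theorem corollary1p4 (K : Type*) [Field K] [NumberField K]
    (φ : ℝ → mixedEmbedding.mixedSpace K) (hφ : ContDiffOn ℝ 1 φ (Icc 0 1))
    (hT : {x ∈ Icc (0 : ℝ) 1 |
      ¬ ((Module.finrank ℚ K : ℝ) / 2 <
        ((movingReal φ x).ncard : ℝ) + 2 * ((movingComplex φ x).ncard : ℝ))}.Countable) :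
    IsAbsoluteWinningOn (Icc (0 : ℝ) 1) (φ ⁻¹' badlyApproximable K) ∧
      IsSchmidtWinningOn (Icc (0 : ℝ) 1) (φ ⁻¹' badlyApproximable K) := by
  refine winning_of_target fun β hβ hβ' ↦ ?_
  obtain ⟨G₀, hG₀⟩ := exists_integer_lt_of_majority K
  set b := β ^ (Fintype.card (InfinitePlace K) + 1) with hb
  have hb0 : 0 < b := by positivity
  -- Heights grow by `G` and lengths shrink by `G ^ 2`, so `A = G ^ 2` must leave Bob one move more
  -- than there are places.
  obtain ⟨G, hG1, hGG, hGb⟩ : ∃ G : ℝ, 1 < G ∧ G₀ < G ∧ b⁻¹ ≤ G :=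
    ⟨max 2 (max (G₀ + 1) b⁻¹), lt_max_of_lt_left (by norm_num),
      lt_max_of_lt_right (lt_max_of_lt_left (by linarith)),
      (le_max_right _ _).trans (le_max_right _ _)⟩
  have hGA : (G ^ 2)⁻¹ ≤ b :=
    inv_le_of_inv_le₀ hb0 (hGb.trans (le_self_pow₀ hG1.le two_ne_zero))
  refine exists_winning_target (ι := InfinitePlace K) isClosed_Icc hT hβ
    (one_lt_pow₀ hG1 two_ne_zero) hGA (Loc := IsMajorityBilipschitzOn φ) ?_ ?_ ?_
  · rintro U V hUV ⟨T, hT, l, hl, L, hL, h⟩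
    exact ⟨T, hT, l, hl, L, hL, fun s hs t ht ↦ h s (hUV hs) t (hUV ht)⟩
  · intro x hx hxE
    exact exists_nhds_isMajorityBilipschitzOn hφ hx (by
      by_contra h
      exact hxE ⟨hx, h⟩)
  · exact fun V hV R hR ↦ hV.exists_obstacles hβ hG1 (hG₀ G hG1 hGG) hR
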